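/- Let $n,d\ge 0$ be integers. Write $B_r(x)$ for the open ball of $\mathbb{R}^{n+d}$ with centre $x$ and radius $r$, let $\mathcal H^n$ be the $n$-dimensional Hausdorff measure, and for $M\subset\mathbb{R}^{n+d}$ put $\mu=\mathcal H^n\llcorner M$; $-\!\!\!\!\!\!\int_{B_r(x)} f\,d\mu$ denotes the average $\mu(B_r(x))^{-1}\int_{B_r(x)}f\,d\mu$ and $f_{x,r}$ its value. Definitions. $M$ is *$n$-rectifiable* if it is $\mathcal H^n$-measurable and $M\subset M_0\cup\bigcup_{i}f_i(A_i)$ with $\mathcal H^n(M_0)=0$ and countably many Lipschitz maps $f_i:A_i\to\mathbb{R}^{n+d}$, $A_i\subset\mathbb{R}^n$. $M$ is *$n$-Ahlfors regular with constant $C_M\ge1$* if it is closed and $C_M^{-1}r^n\le\mu(B_r(x))\le C_Mr^n$ for all $x\in M$, $0<r\le1$. An $n$-dimensional linear subspace $T_yM$ is the *approximate tangent space* of $M$ at $y$ if $\lim_{h\to0^+}h^{-n}\int_M f(h^{-1}(z-y))\,d\mathcal H^n(z)=\int_{T_yM}f\,d\mathcal H^n$ for all $f\in C^1_c(\mathbb{R}^{n+d},\mathbb{R})$;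 for the sets below it exists for $\mu$-a.e. $y$. For $f$ Lipschitz on $\mathbb{R}^{n+d}$, $\nabla^Mf(y)$ is the gradient at $y$ of the restriction of $f$ to $y+T_yM$; it exists for $\mu$-a.e. $y$. Let $\pi_{T_yM}=(a_{ij}(y))_{ij}$ be the matrix of the orthogonal projection onto $T_yM$ in the standard basis, $A_{x,r}=((a_{ij})_{x,r})_{ij}$ the matrix of the averages of its entries over $B_r(x)$, $|\cdot|$ the Frobenius norm of matrices, and $$\alpha(x,r)=\Big(-\!\!\!\!\!\!\int_{B_r(x)}|\pi_{T_yM}-A_{x,r}|^2\,d\mu(y)\Big)^{1/2}.$$ Theorem. For every $C_M\ge1$ there is $\epsilon_1=\epsilon_1(n,d,C_M)>0$, and for every $C_P>0$ there is $C=C(n,d,C_P)>0$, such that the following holds for all $C_M\ge 1$, $C_P>0$ and $\lambda\ge1$. Let $M\subset B_2(0)\subset\mathbb{R}^{n+d}$ be an $n$-rectifiable, $n$-Ahlfors regular set with constant $C_M$ that contains the origin and satisfies the Poincaré-type inequality $$-\!\!\!\!\!\!\int_{B_r(x)}|f(y)-f_{x,r}|\,d\mu(y)\le C_P\,r\Big(-\!\!\!\!\!\!\int_{B_{\lambda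 r}(x)}|\nabla^Mf(y)|^2\,d\mu(y)\Big)^{1/2}$$ for all $x\in M$, $r>0$ and all Lipschitz functions $f:\mathbb{R}^{n+d}\to\mathbb{R}$. If for some $0<\epsilon\le\epsilon_1$ $$\int_0^1\Big(-\!\!\!\!\!\!\int_{B_r(x)}|\pi_{T_yM}-A_{x,r}|^2\,d\mu(y)\Big)\frac{dr}{r}<\epsilon^2\qquad\text{for all }x\in M,$$ then for every $x\in M$ and every $0<r\le\frac1{10\lambda}$ there is an affine $n$-dimensional plane $P_{x,r}\subset\mathbb{R}^{n+d}$ with $$-\!\!\!\!\!\!\int_{B_r(x)}\frac{d(y,P_{x,r})}{r}\,d\mu(y)\le C\,\alpha(x,\lambda r).$$ -/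

import Mathlib

open MeasureTheory Set Filter Topology Metric
open scoped ENNReal NNReal

noncomputable section

namespace PoincarePlanes

/-- `M ⊆ ℝ^(n+d)` is (countably) `n`-rectifiable: it is `ℋⁿ`-measurable (in the sense of
Carathéodory) and, up to an `ℋⁿ`-null set, it is covered by countably many Lipschitz images of
subsets of `ℝⁿ`.  Here `μHE[n]` is the `n`-dimensional Hausdorff measure, normalised so that it
is Lebesgue measure on `ℝⁿ`. -/
def IsRectifiable (n d : ℕ) (M : Set (EuclideanSpace ℝ (Fin (n + d)))) : Prop :=
  (μHE[n] : Measure (EuclideanSpace ℝ (Fin (n + d)))).toOuterMeasure.IsCaratheodory M ∧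
  ∃ (M₀ : Set (EuclideanSpace ℝ (Fin (n + d))))
    (A : ℕ → Set (EuclideanSpace ℝ (Fin n)))
    (f : ℕ → EuclideanSpace ℝ (Fin n) → EuclideanSpace ℝ (Fin (n + d))),
    (μHE[n] : Measure (EuclideanSpace ℝ (Fin (n + d)))) M₀ = 0 ∧
    (∀ i, ∃ K : ℝ≥0, LipschitzOnWith K (f i) (A i)) ∧
    M ⊆ M₀ ∪ ⋃ i, f i '' A i

/-- The measure `μ = ℋⁿ ⌞ M`. -/
def surfaceMeasure (n d : ℕ) (M : Set (EuclideanSpace ℝ (Fin (n + d)))) :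
    Measure (EuclideanSpace ℝ (Fin (n + d))) :=
  (μHE[n] : Measure (EuclideanSpace ℝ (Fin (n + d)))).restrict M

/-- `M` is a (closed) `n`-Ahlfors regular set with Ahlfors regularity constant `C_M ≥ 1`. -/
def IsAhlforsRegular (n d : ℕ) (C_M : ℝ) (M : Set (EuclideanSpace ℝ (Fin (n + d)))) : Prop :=
  IsClosed M ∧ 1 ≤ C_M ∧
  ∀ x ∈ M, ∀ r : ℝ, 0 < r → r ≤ 1 →
    ENNReal.ofReal (C_M⁻¹ * r ^ n) ≤ surfaceMeasure n d M (ball x r) ∧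
    surfaceMeasure n d M (ball x r) ≤ ENNReal.ofReal (C_M * r ^ n)

/-- The `n`-dimensional linear subspace `P` is the approximate tangent space of `M` at `x`. -/
def IsApproxTangentSpace (n d : ℕ) (M : Set (EuclideanSpace ℝ (Fin (n + d))))
    (x : EuclideanSpace ℝ (Fin (n + d)))
    (P : Submodule ℝ (EuclideanSpace ℝ (Fin (n + d)))) : Prop :=
  Module.finrank ℝ P = n ∧
  ∀ f : EuclideanSpace ℝ (Fin (n + d)) → ℝ, ContDiff ℝ 1 f → HasCompactSupport f →
    Tendsto (fun h : ℝ => (h ^ n)⁻¹ * ∫ y in M, f (h⁻¹ • (y - x)) ∂μHE[n]) (𝓝[>] 0)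
      (𝓝 (∫ y in (P : Set (EuclideanSpace ℝ (Fin (n + d)))), f y ∂μHE[n]))

open scoped Classical in
/-- The approximate tangent space `T_y M`.  Where it does not exist (for a rectifiable set of
locally finite `ℋⁿ` measure, an `ℋⁿ`-null subset of `M`) it is given the dummy value `⊥`. -/
def tangentSpace (n d : ℕ) (M : Set (EuclideanSpace ℝ (Fin (n + d))))
    (y : EuclideanSpace ℝ (Fin (n + d))) :
    Submodule ℝ (EuclideanSpace ℝ (Fin (n + d))) :=
  if h : ∃ P, IsApproxTangentSpace n d M y P then h.choose else ⊥

/-- The matrix `(a_ij(y))` of the orthogonal projection `π_{T_y M}` in the standard basis: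
its `j`-th column is `π_{T_y M} e_j`. -/
def tangentProj (n d : ℕ) (M : Set (EuclideanSpace ℝ (Fin (n + d))))
    (y : EuclideanSpace ℝ (Fin (n + d))) : Matrix (Fin (n + d)) (Fin (n + d)) ℝ :=
  Matrix.of fun i j => ((tangentSpace n d M y).starProjection (EuclideanSpace.single j 1)) i

/-- The tangential derivative `∇^M f(y)`: the gradient at `y` of the restriction of `f` to the
affine subspace `y + T_y M`, written as the gradient at `0` of `t ↦ f (y + t)` on `T_y M`. -/
def tangentialGradient (n d : ℕ) (M : Set (EuclideanSpace ℝ (Fin (n + d))))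
    (f : EuclideanSpace ℝ (Fin (n + d)) → ℝ) (y : EuclideanSpace ℝ (Fin (n + d))) :
    EuclideanSpace ℝ (Fin (n + d)) :=
  ((gradient (fun t : tangentSpace n d M y =>
      f (y + (t : EuclideanSpace ℝ (Fin (n + d))))) 0 : tangentSpace n d M y) :
    EuclideanSpace ℝ (Fin (n + d)))

/-- The Poincaré-type inequality with Poincaré constant `C_P` and dilation constant `lam`, for all
balls centred on `M` and all Lipschitz functions on `ℝ^(n+d)`. -/
def SatisfiesPoincare (n d : ℕ) (C_P lam : ℝ) (M : Set (EuclideanSpace ℝ (Fin (n + d)))) :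
    Prop :=
  ∀ x ∈ M, ∀ r : ℝ, 0 < r → ∀ f : EuclideanSpace ℝ (Fin (n + d)) → ℝ,
    (∃ K : ℝ≥0, LipschitzWith K f) →
    ⨍⁻ y in ball x r, ‖f y - ⨍ z in ball x r, f z ∂(surfaceMeasure n d M)‖ₑ
        ∂(surfaceMeasure n d M)
      ≤ ENNReal.ofReal (C_P * r) *
        (⨍⁻ y in ball x (lam * r), ‖tangentialGradient n d M f y‖ₑ ^ 2
          ∂(surfaceMeasure n d M)) ^ (1 / 2 : ℝ)

/-- The matrix `A_{x,r}`, whose entries are the averages of the `a_ij` over `B_r(x)`. -/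
def meanProj (n d : ℕ) (M : Set (EuclideanSpace ℝ (Fin (n + d))))
    (x : EuclideanSpace ℝ (Fin (n + d))) (r : ℝ) : Matrix (Fin (n + d)) (Fin (n + d)) ℝ :=
  Matrix.of fun i j => ⨍ y in ball x r, tangentProj n d M y i j ∂(surfaceMeasure n d M)

/-- The mean square oscillation `⨍_{B_r(x)} |π_{T_y M} - A_{x,r}|² dμ(y)`, with the Frobenius
norm. -/
def oscSq (n d : ℕ) (M : Set (EuclideanSpace ℝ (Fin (n + d))))
    (x : EuclideanSpace ℝ (Fin (n + d))) (r : ℝ) : ℝ≥0∞ :=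
  ⨍⁻ y in ball x r,
    ENNReal.ofReal (∑ i, ∑ j, (tangentProj n d M y i j - meanProj n d M x r i j) ^ 2)
    ∂(surfaceMeasure n d M)

/-- The number `α(x, r)`. -/
def alpha (n d : ℕ) (M : Set (EuclideanSpace ℝ (Fin (n + d))))
    (x : EuclideanSpace ℝ (Fin (n + d))) (r : ℝ) : ℝ≥0∞ :=
  oscSq n d M x r ^ (1 / 2 : ℝ)

/-- The Carleson-type condition with constant `ε`, at every point of `M`. -/
def SatisfiesCarleson (n d : ℕ) (ε : ℝ) (M : Set (EuclideanSpace ℝ (Fin (n + d)))) : Prop :=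
  ∀ x ∈ M, ∫⁻ r in Ioo (0 : ℝ) 1, oscSq n d M x r / ENNReal.ofReal r < ENNReal.ofReal (ε ^ 2)

end PoincarePlanes

end

namespace PoincarePlanes

/-! The Poincaré inequality is applied to the linear functions `⟨v_k, ·⟩`, with `v` an orthonormal
`d`-frame almost normal to `M` on average; their tangential gradients are `π_{T_y M} v_k`. Let `B =
A_{x,λr}`, and let `v` minimise `∑ |B v_k|²` over all orthonormal `d`-frames. At each `y` a frame
`u` normal to `T_y M` satisfies `|B u_k| ≤ |π_{T_y M} - B|`, so minimality gives `∑ |B v_k|² ≤ d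
|π_{T_y M} - B|²`, and averaging gives `d α(x,λr)²` (`exists_frame`).

Hence the mean square of `π_{T_y M} v_k` is at most `2(d+1) α(x,λr)²`
(`laverage_tangentialGradient_le`). By Poincaré each `⟨v_k, ·⟩` is close in mean to its average
`m_k` on `B_r(x)`, and the distance to the plane `{⟨v_k, z⟩ = m_k}` is at most the sum of these
deviations (`exists_affineSubspace_infDist_le`). -/

/-- The squared Frobenius distance of `π_{T_y M}` to a matrix `B`. -/
noncomputable def projDistSq (n d : ℕ) (M : Set (EuclideanSpace ℝ (Fin (n + d))))
    (B : Matrix (Fin (n + d)) (Fin (n + d)) ℝ) (y : EuclideanSpace ℝ (Fin (n + d))) : ℝ :=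
  ∑ i, ∑ j, (tangentProj n d M y i j - B i j) ^ 2

/-! ### Projections and matrices acting on vectors. -/

theorem sum_sq_mulVec_le {ι : Type*} [Fintype ι] (B : Matrix ι ι ℝ) (v : EuclideanSpace ℝ ι) :
    ∑ i, (∑ j, B i j * v j) ^ 2 ≤ (∑ i, ∑ j, B i j ^ 2) * ‖v‖ ^ 2 := by
  rw [Finset.sum_mul, EuclideanSpace.real_norm_sq_eq]
  exact Finset.sum_le_sum fun i _ => Finset.sum_mul_sq_le_sq_mul_sq _ _ _

theorem tangentProj_mulVec (n d : ℕ) (M : Set (EuclideanSpace ℝ (Fin (n + d))))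
    (y v : EuclideanSpace ℝ (Fin (n + d))) (i : Fin (n + d)) :
    ∑ j, tangentProj n d M y i j * v j = (tangentSpace n d M y).starProjection v i := by
  have hv : v = ∑ j, v j • EuclideanSpace.single j (1 : ℝ) := by
    ext i
    simp [Finset.sum_apply, Pi.single_apply]
  conv_rhs => rw [hv, map_sum]
  simp [tangentProj, mul_comm]

/-- On `y + T_y M` the function is affine, and its linear part is represented by the projection of
`v`. -/
theorem tangentialGradient_inner (n d : ℕ) (M : Set (EuclideanSpace ℝ (Fin (n + d))))
    (y v : EuclideanSpace ℝ (Fin (n + d))) :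
    tangentialGradient n d M (fun z => inner ℝ v z) y
      = (tangentSpace n d M y).starProjection v := by
  unfold tangentialGradient
  have h : HasGradientAt (fun t : tangentSpace n d M y =>
      inner ℝ v (y + (t : EuclideanSpace ℝ (Fin (n + d)))))
      ((tangentSpace n d M y).orthogonalProjectionOnto v) 0 := by
    rw [hasGradientAt_iff_hasFDerivAt]
    have h1 : HasFDerivAt (fun t : tangentSpace n d M y =>
        inner ℝ v y + ((innerSL ℝ v).comp (tangentSpace n d M y).subtypeL) t)
        ((innerSL ℝ v).comp (tangentSpace n d M y).subtypeL) 0 :=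
      (ContinuousLinearMap.hasFDerivAt _).const_add _
    refine (h1.congr_fderiv ?_).congr_of_eventuallyEq (Eventually.of_forall fun t => ?_)
    · ext t
      rw [InnerProductSpace.toDual_apply_apply, Submodule.coe_inner, real_inner_comm,
        ← Submodule.coe_inner, Submodule.inner_orthogonalProjectionOnto_eq_of_mem_left,
        real_inner_comm]
      rfl
    · simp [inner_add_right]
  rw [h.gradient]
  rfl

/-- Split `π v = B v + (π - B) v` and use `(a + b)² ≤ 2a² + 2b²` in each coordinate. -/
theorem norm_sq_starProjection_le (n d : ℕ) (M : Set (EuclideanSpace ℝ (Fin (n + d))))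
    (B : Matrix (Fin (n + d)) (Fin (n + d)) ℝ) (y v : EuclideanSpace ℝ (Fin (n + d)))
    (hv : ‖v‖ = 1) :
    ‖(tangentSpace n d M y).starProjection v‖ ^ 2
      ≤ 2 * ∑ i, (∑ j, B i j * v j) ^ 2 + 2 * projDistSq n d M B y := by
  have h := sum_sq_mulVec_le (tangentProj n d M y - B) v
  rw [hv, one_pow, mul_one] at h
  rw [EuclideanSpace.real_norm_sq_eq]
  refine le_trans ?_ (add_le_add_right (mul_le_mul_of_nonneg_left h zero_le_two) _)
  rw [Finset.mul_sum, Finset.mul_sum, ← Finset.sum_add_distrib]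
  refine Finset.sum_le_sum fun i _ => ?_
  rw [← tangentProj_mulVec]
  simp only [Matrix.sub_apply, sub_mul, Finset.sum_sub_distrib]
  nlinarith [sq_nonneg (∑ j, B i j * v j -
    (∑ j, tangentProj n d M y i j * v j - ∑ j, B i j * v j))]

/-- Since `π v = 0` for normal `v`, one has `B v = -(π - B) v`. -/
theorem sum_sq_mulVec_le_projDistSq (n d : ℕ) (M : Set (EuclideanSpace ℝ (Fin (n + d))))
    (B : Matrix (Fin (n + d)) (Fin (n + d)) ℝ) (y v : EuclideanSpace ℝ (Fin (n + d)))
    (hv : ‖v‖ = 1) (hT : v ∈ (tangentSpace n d M y)ᗮ) :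
    ∑ i, (∑ j, B i j * v j) ^ 2 ≤ projDistSq n d M B y := by
  have h := sum_sq_mulVec_le (tangentProj n d M y - B) v
  rw [hv, one_pow, mul_one] at h
  refine le_trans (le_of_eq ?_) h
  refine Finset.sum_congr rfl fun i _ => ?_
  simp only [Matrix.sub_apply, sub_mul, Finset.sum_sub_distrib, tangentProj_mulVec]
  rw [show (tangentSpace n d M y).starProjection v = 0 from
    Submodule.eq_starProjection_of_mem_of_inner_eq_zero (Submodule.zero_mem _) fun w hw => by
      rw [sub_zero]
      exact Submodule.inner_left_of_mem_orthogonal hw hT]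
  simp

/-! ### Normal frames and the minimising frame. -/

theorem finrank_tangentSpace_le (n d : ℕ) (M : Set (EuclideanSpace ℝ (Fin (n + d))))
    (y : EuclideanSpace ℝ (Fin (n + d))) : Module.finrank ℝ (tangentSpace n d M y) ≤ n := by
  by_cases h : ∃ P, IsApproxTangentSpace n d M y P
  · rw [tangentSpace, dif_pos h]
    exact h.choose_spec.1.le
  · rw [tangentSpace, dif_neg h, finrank_bot]
    exact n.zero_le

/-- The tangent space has dimension at most `n`, also for the dummy value `⊥`, so a normal frame
exists at every `y`, not just almost every one. -/
theorem exists_orthonormal_tangentSpace_orthogonal (n d : ℕ)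
    (M : Set (EuclideanSpace ℝ (Fin (n + d)))) (y : EuclideanSpace ℝ (Fin (n + d))) :
    ∃ v : Fin d → EuclideanSpace ℝ (Fin (n + d)),
      Orthonormal ℝ v ∧ ∀ k, v k ∈ (tangentSpace n d M y)ᗮ := by
  have h1 := (tangentSpace n d M y).finrank_add_finrank_orthogonal
  have h2 := finrank_tangentSpace_le n d M y
  rw [finrank_euclideanSpace_fin] at h1
  have h3 : d ≤ Module.finrank ℝ (tangentSpace n d M y)ᗮ := by omega
  let b := stdOrthonormalBasis ℝ (tangentSpace n d M y)ᗮ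
  refine ⟨fun k => (b (Fin.castLE h3 k) : EuclideanSpace ℝ (Fin (n + d))), ?_, fun k => by simp⟩
  exact (b.orthonormal.comp _ (Fin.castLE_injective h3)).comp_linearIsometry
    (tangentSpace n d M y)ᗮ.subtypeₗᵢ

theorem isCompact_setOf_orthonormal (N d : ℕ) :
    IsCompact {v : Fin d → EuclideanSpace ℝ (Fin N) | Orthonormal ℝ v} := by
  refine Metric.isCompact_of_isClosed_isBounded ?_ ?_
  · simp only [orthonormal_iff_ite, Set.ofPred_forall]
    exact isClosed_iInter fun i => isClosed_iInter fun j =>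
      isClosed_eq (by fun_prop) continuous_const
  · refine (Metric.isBounded_closedBall (x := 0) (r := 1)).subset fun v hv => ?_
    rw [mem_closedBall_zero_iff, pi_norm_le_iff_of_nonneg zero_le_one]
    exact fun k => (hv.1 k).le

/-- If the mean of `|π_{T_y M} - B|²` is `a`, some orthonormal `d`-frame `v` has
`|B v_k|² ≤ d a`. -/
theorem exists_frame (n d : ℕ) (M : Set (EuclideanSpace ℝ (Fin (n + d))))
    (B : Matrix (Fin (n + d)) (Fin (n + d)) ℝ) (s : Set (EuclideanSpace ℝ (Fin (n + d))))
    (h0 : surfaceMeasure n d M s ≠ 0) (htop : surfaceMeasure n d M s ≠ ∞) :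
    ∃ v : Fin d → EuclideanSpace ℝ (Fin (n + d)), Orthonormal ℝ v ∧
      ∀ k, ENNReal.ofReal (∑ i, (∑ j, B i j * v k j) ^ 2)
        ≤ d * ⨍⁻ y in s, ENNReal.ofReal (projDistSq n d M B y) ∂(surfaceMeasure n d M) := by
  set a := ⨍⁻ y in s, ENNReal.ofReal (projDistSq n d M B y) ∂(surfaceMeasure n d M) with ha
  obtain ⟨w, hw, -⟩ := exists_orthonormal_tangentSpace_orthogonal n d M 0
  obtain ⟨v, hv, hmin⟩ := (isCompact_setOf_orthonormal (n + d) d).exists_isMinOn ⟨w, hw⟩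
    (f := fun v => ∑ k, ∑ i, (∑ j, B i j * v k j) ^ 2) (by fun_prop)
  refine ⟨v, hv, fun k => ?_⟩
  have hk : ∑ i, (∑ j, B i j * v k j) ^ 2 ≤ ∑ k, ∑ i, (∑ j, B i j * v k j) ^ 2 :=
    Finset.single_le_sum (f := fun k => ∑ i, (∑ j, B i j * v k j) ^ 2)
      (fun k _ => Finset.sum_nonneg fun i _ => sq_nonneg _) (Finset.mem_univ k)
  by_cases hat : a = ∞
  · have hd : (d : ℝ≥0∞) ≠ 0 := by
      simpa using (Fin.pos k).ne'
    rw [hat, ENNReal.mul_top hd]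
    exact le_top
  -- The left side does not depend on `y`: the minimiser `v` is compared with a normal frame `u` at
  -- `y`, which need not be chosen measurably.
  have key : ∀ y, ENNReal.ofReal (∑ i, (∑ j, B i j * v k j) ^ 2)
      ≤ d * ENNReal.ofReal (projDistSq n d M B y) := by
    intro y
    obtain ⟨u, hu, huT⟩ := exists_orthonormal_tangentSpace_orthogonal n d M y
    have h1 : ∑ k, ∑ i, (∑ j, B i j * u k j) ^ 2 ≤ d * projDistSq n d M B y := by
      refine (Finset.sum_le_card_nsmul _ _ _ fun k _ =>
        sum_sq_mulVec_le_projDistSq n d M B y (u k) (hu.1 k) (huT k)).trans_eq ?_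
      simp
    rw [← ENNReal.ofReal_natCast, ← ENNReal.ofReal_mul (Nat.cast_nonneg d)]
    exact ENNReal.ofReal_le_ofReal (hk.trans ((hmin hu).trans h1))
  calc ENNReal.ofReal (∑ i, (∑ j, B i j * v k j) ^ 2)
      = ⨍⁻ _ in s, ENNReal.ofReal (∑ i, (∑ j, B i j * v k j) ^ 2) ∂(surfaceMeasure n d M) :=
        (setLAverage_const h0 htop _).symm
    _ ≤ ⨍⁻ y in s, d * ENNReal.ofReal (projDistSq n d M B y) ∂(surfaceMeasure n d M) :=
        lintegral_mono key
    _ = d * a := lintegral_const_mul' _ _ (ENNReal.natCast_ne_top d)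

/-- The mean square of the tangential gradient of a linear function `⟨v, ·⟩`. -/
theorem laverage_tangentialGradient_le (n d : ℕ) (M : Set (EuclideanSpace ℝ (Fin (n + d))))
    (B : Matrix (Fin (n + d)) (Fin (n + d)) ℝ) (s : Set (EuclideanSpace ℝ (Fin (n + d))))
    (h0 : surfaceMeasure n d M s ≠ 0) (htop : surfaceMeasure n d M s ≠ ∞)
    (v : EuclideanSpace ℝ (Fin (n + d))) (hv : ‖v‖ = 1) :
    ⨍⁻ y in s, ‖tangentialGradient n d M (fun z => inner ℝ v z) y‖ₑ ^ 2 ∂(surfaceMeasure n d M)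
      ≤ 2 * ENNReal.ofReal (∑ i, (∑ j, B i j * v j) ^ 2)
        + 2 * ⨍⁻ y in s, ENNReal.ofReal (projDistSq n d M B y) ∂(surfaceMeasure n d M) := by
  have hpt : ∀ y, ‖tangentialGradient n d M (fun z => inner ℝ v z) y‖ₑ ^ 2
      ≤ 2 * ENNReal.ofReal (∑ i, (∑ j, B i j * v j) ^ 2)
        + 2 * ENNReal.ofReal (projDistSq n d M B y) := by
    intro y
    have hD : 0 ≤ projDistSq n d M B y :=
      Finset.sum_nonneg fun i _ => Finset.sum_nonneg fun j _ => sq_nonneg _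
    have htwo (a : ℝ) : ENNReal.ofReal (2 * a) = 2 * ENNReal.ofReal a := by
      rw [ENNReal.ofReal_mul zero_le_two, ENNReal.ofReal_ofNat]
    rw [tangentialGradient_inner, ← ofReal_norm, ← ENNReal.ofReal_pow (norm_nonneg _),
      ← htwo, ← htwo,
      ← ENNReal.ofReal_add (by positivity) (by positivity)]
    exact ENNReal.ofReal_le_ofReal (norm_sq_starProjection_le n d M B y v hv)
  refine (lintegral_mono hpt).trans_eq ?_
  -- The constant summand is measurable and the factor 2 finite, so no measurability of `y ↦ T_y M`
  -- is needed.
  rw [lintegral_add_left measurable_const,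
    lintegral_const_mul' 2 (fun y => ENNReal.ofReal (projDistSq n d M B y)) (by simp)]
  congr 1
  exact setLAverage_const h0 htop _

/-! ### The plane and the Poincaré estimate. -/

/-- The affine plane `{z | ⟨v_k, z⟩ = m_k}` for an orthonormal family `v`. -/
theorem exists_affineSubspace_infDist_le {n d : ℕ}
    (v : Fin d → EuclideanSpace ℝ (Fin (n + d))) (hv : Orthonormal ℝ v) (m : Fin d → ℝ) :
    ∃ P : AffineSubspace ℝ (EuclideanSpace ℝ (Fin (n + d))),
      (P : Set (EuclideanSpace ℝ (Fin (n + d)))).Nonempty ∧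
      Module.finrank ℝ P.direction = n ∧
      ∀ y, infDist y (P : Set (EuclideanSpace ℝ (Fin (n + d))))
        ≤ ∑ k, |inner ℝ (v k) y - m k| := by
  let V := (Submodule.span ℝ (Set.range v))ᗮ
  have hinner : ∀ (c : Fin d → ℝ) k, inner ℝ (v k) (∑ l, c l • v l) = c k := fun c k =>
    hv.inner_right_fintype c k
  refine ⟨AffineSubspace.mk' (∑ k, m k • v k) V, ⟨_, AffineSubspace.self_mem_mk' _ _⟩, ?_, ?_⟩
  · rw [AffineSubspace.direction_mk']
    have h1 := (Submodule.span ℝ (Set.range v)).finrank_add_finrank_orthogonal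
    rw [finrank_euclideanSpace_fin, finrank_span_eq_card hv.linearIndependent,
      Fintype.card_fin] at h1
    change Module.finrank ℝ (Submodule.span ℝ (Set.range v))ᗮ = n
    omega
  · intro y
    -- The competitor for the distance is `y` with its deviations along the `v_k` removed.
    have hmem : y - ∑ k, (inner ℝ (v k) y - m k) • v k
        ∈ (AffineSubspace.mk' (∑ k, m k • v k) V : Set (EuclideanSpace ℝ (Fin (n + d)))) := by
      rw [SetLike.mem_coe, AffineSubspace.mem_mk', Submodule.mem_orthogonal]
      intro u hu
      induction hu using Submodule.span_induction with
      | mem u hu =>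
        obtain ⟨k, rfl⟩ := hu
        rw [vsub_eq_sub, inner_sub_right, inner_sub_right, hinner, hinner]
        ring
      | zero => simp
      | add a b _ _ ha hb => rw [inner_add_left, ha, hb, add_zero]
      | smul c a _ ha => rw [inner_smul_left, ha, mul_zero]
    refine (infDist_le_dist_of_mem hmem).trans ?_
    rw [dist_eq_norm, sub_sub_cancel]
    refine (norm_sum_le _ _).trans (Finset.sum_le_sum fun k _ => ?_)
    rw [norm_smul, hv.1 k, mul_one, Real.norm_eq_abs]

theorem IsAhlforsRegular.measure_ball_ne {n d : ℕ} {C_M : ℝ}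
    {M : Set (EuclideanSpace ℝ (Fin (n + d)))} (hM : IsAhlforsRegular n d C_M M)
    {x : EuclideanSpace ℝ (Fin (n + d))} (hx : x ∈ M) {r : ℝ} (hr : 0 < r) (hr1 : r ≤ 1) :
    surfaceMeasure n d M (ball x r) ≠ 0 ∧ surfaceMeasure n d M (ball x r) ≠ ∞ := by
  obtain ⟨-, h1, h⟩ := hM
  obtain ⟨hl, hu⟩ := h x hx r hr hr1
  refine ⟨fun h0 => ?_, (hu.trans_lt ENNReal.ofReal_lt_top).ne⟩
  rw [h0, nonpos_iff_eq_zero, ENNReal.ofReal_eq_zero] at hl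
  have : 0 < C_M⁻¹ * r ^ n := by positivity
  linarith

/-- The Poincaré inequality for the coordinate functions normal to a good frame. -/
theorem SatisfiesPoincare.laverage_inner_le {n d : ℕ} {C_P lam : ℝ}
    {M : Set (EuclideanSpace ℝ (Fin (n + d)))} (hP : SatisfiesPoincare n d C_P lam M)
    {x : EuclideanSpace ℝ (Fin (n + d))} (hx : x ∈ M) {r : ℝ} (hr : 0 < r)
    (h0 : surfaceMeasure n d M (ball x (lam * r)) ≠ 0)
    (htop : surfaceMeasure n d M (ball x (lam * r)) ≠ ∞)
    (v : EuclideanSpace ℝ (Fin (n + d))) (hv : ‖v‖ = 1)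
    (hB : ENNReal.ofReal (∑ i, (∑ j, meanProj n d M x (lam * r) i j * v j) ^ 2)
      ≤ d * oscSq n d M x (lam * r)) :
    ⨍⁻ y in ball x r, ‖inner ℝ v y - ⨍ z in ball x r, inner ℝ v z ∂(surfaceMeasure n d M)‖ₑ
        ∂(surfaceMeasure n d M)
      ≤ ENNReal.ofReal (C_P * r) * (ENNReal.ofReal (2 * (d + 1)) * alpha n d M x (lam * r)) := by
  refine (hP x hx r hr (fun z => inner ℝ v z) ⟨_, (innerSL ℝ v).lipschitz⟩).trans ?_
  gcongr
  refine (ENNReal.rpow_le_rpow (laverage_tangentialGradient_le n d M (meanProj n d M x (lam * r)) _ h0 htop v hv)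
    (by norm_num)).trans ?_
  -- Since `2(d+1) ≥ 1`, its square root is at most itself, which keeps roots out of the final
  -- constant.
  have hc : (1 : ℝ≥0∞) ≤ ENNReal.ofReal (2 * (d + 1)) := by
    rw [ENNReal.one_le_ofReal]
    have : (0 : ℝ) ≤ d := Nat.cast_nonneg d
    linarith
  calc _ ≤ (ENNReal.ofReal (2 * (d + 1)) * oscSq n d M x (lam * r)) ^ (1 / 2 : ℝ) := by
        refine ENNReal.rpow_le_rpow ?_ (by norm_num)
        have h1 : ENNReal.ofReal (2 * (d + 1)) = 2 * d + 2 := by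
          rw [ENNReal.ofReal_mul zero_le_two, ENNReal.ofReal_add (Nat.cast_nonneg d) zero_le_one]
          simp [mul_add]
        rw [h1, add_mul, mul_assoc]
        exact add_le_add_left (mul_le_mul_right hB _) _
    _ = ENNReal.ofReal (2 * (d + 1)) ^ (1 / 2 : ℝ) * alpha n d M x (lam * r) :=
        ENNReal.mul_rpow_of_nonneg _ _ (by norm_num)
    _ ≤ _ := by
        gcongr
        conv_rhs => rw [← ENNReal.rpow_one (ENNReal.ofReal _)]
        exact ENNReal.rpow_le_rpow_of_exponent_le hc (by norm_num)

/-- The planes exist, with an explicit constant, whenever the Poincaré inequality holds. -/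
theorem exists_plane_of_poincare {n d : ℕ} {C_M C_P lam : ℝ} (hCP : 0 < C_P) (hlam : 1 ≤ lam)
    {M : Set (EuclideanSpace ℝ (Fin (n + d)))} (hA : IsAhlforsRegular n d C_M M)
    (hP : SatisfiesPoincare n d C_P lam M) {x : EuclideanSpace ℝ (Fin (n + d))} (hx : x ∈ M)
    {r : ℝ} (hr : 0 < r) (hr1 : lam * r ≤ 1) :
    ∃ P : AffineSubspace ℝ (EuclideanSpace ℝ (Fin (n + d))),
      (P : Set (EuclideanSpace ℝ (Fin (n + d)))).Nonempty ∧
      Module.finrank ℝ P.direction = n ∧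
      ⨍⁻ y in ball x r, ENNReal.ofReal (infDist y (P : Set _) / r) ∂(surfaceMeasure n d M)
        ≤ ENNReal.ofReal (d * (C_P * (2 * (d + 1)))) * alpha n d M x (lam * r) := by
  obtain ⟨h0, htop⟩ := hA.measure_ball_ne hx (r := lam * r) (by positivity) hr1
  obtain ⟨v, hv, hB⟩ := exists_frame n d M (meanProj n d M x (lam * r)) _ h0 htop
  obtain ⟨P, hne, hrank, hdist⟩ := exists_affineSubspace_infDist_le v hv
    fun k => ⨍ z in ball x r, inner ℝ (v k) z ∂(surfaceMeasure n d M)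
  refine ⟨P, hne, hrank, ?_⟩
  have hpt : ∀ y, ENNReal.ofReal (infDist y (P : Set (EuclideanSpace ℝ (Fin (n + d)))) / r)
      ≤ ENNReal.ofReal r⁻¹ * ∑ k,
        ‖inner ℝ (v k) y - ⨍ z in ball x r, inner ℝ (v k) z ∂(surfaceMeasure n d M)‖ₑ := by
    intro y
    simp only [Real.enorm_eq_ofReal_abs]
    rw [← ENNReal.ofReal_sum_of_nonneg fun k _ => abs_nonneg _,
      ← ENNReal.ofReal_mul (inv_nonneg.mpr hr.le), div_eq_inv_mul]
    exact ENNReal.ofReal_le_ofReal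
      (mul_le_mul_of_nonneg_left (hdist y) (inv_nonneg.mpr hr.le))
  calc _ ≤ ⨍⁻ y in ball x r, ENNReal.ofReal r⁻¹ * ∑ k,
        ‖inner ℝ (v k) y - ⨍ z in ball x r, inner ℝ (v k) z ∂(surfaceMeasure n d M)‖ₑ
          ∂(surfaceMeasure n d M) := lintegral_mono hpt
    _ = ENNReal.ofReal r⁻¹ * ∑ k, ⨍⁻ y in ball x r,
        ‖inner ℝ (v k) y - ⨍ z in ball x r, inner ℝ (v k) z ∂(surfaceMeasure n d M)‖ₑ
          ∂(surfaceMeasure n d M) := by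
        unfold laverage
        rw [lintegral_const_mul' _ _ ENNReal.ofReal_ne_top, lintegral_finsetSum]
        intro k _
        exact Continuous.measurable (by fun_prop)
    _ ≤ ENNReal.ofReal r⁻¹ * ∑ _k : Fin d, ENNReal.ofReal (C_P * r) *
        (ENNReal.ofReal (2 * (d + 1)) * alpha n d M x (lam * r)) := by
        gcongr with k
        exact hP.laverage_inner_le hx hr h0 htop (v k) (hv.1 k) (hB k)
    _ = _ := by
        have hd : (0 : ℝ) ≤ d := Nat.cast_nonneg d
        rw [Finset.sum_const, Finset.card_univ, Fintype.card_fin, nsmul_eq_mul,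
          ← ENNReal.ofReal_natCast d, ← mul_assoc, ← mul_assoc, ← mul_assoc,
          ← ENNReal.ofReal_mul (by positivity), ← ENNReal.ofReal_mul (by positivity),
          ← ENNReal.ofReal_mul (by positivity)]
        congr 2
        -- The factor `r` from the Poincaré inequality cancels `r⁻¹`.
        field_simp

end PoincarePlanes

theorem mainTheorem5 (n d : ℕ) :
    ∃ (ε₁ : ℝ → ℝ) (C : ℝ → ℝ),
      (∀ C_M : ℝ, 1 ≤ C_M → 0 < ε₁ C_M) ∧
      (∀ C_P : ℝ, 0 < C_P → 0 < C C_P) ∧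
      ∀ (C_M C_P lam : ℝ), 1 ≤ C_M → 0 < C_P → 1 ≤ lam →
      ∀ M : Set (EuclideanSpace ℝ (Fin (n + d))),
        M ⊆ Metric.ball 0 2 →
        0 ∈ M →
        PoincarePlanes.IsRectifiable n d M →
        PoincarePlanes.IsAhlforsRegular n d C_M M →
        PoincarePlanes.SatisfiesPoincare n d C_P lam M →
        ∀ ε : ℝ, 0 < ε → ε ≤ ε₁ C_M →
        PoincarePlanes.SatisfiesCarleson n d ε M →
        ∀ x ∈ M, ∀ r : ℝ, 0 < r → r ≤ 1 / (10 * lam) →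
        ∃ P : AffineSubspace ℝ (EuclideanSpace ℝ (Fin (n + d))),
          (P : Set (EuclideanSpace ℝ (Fin (n + d)))).Nonempty ∧
          Module.finrank ℝ P.direction = n ∧
          ⨍⁻ y in Metric.ball x r,
              ENNReal.ofReal (Metric.infDist y (P : Set (EuclideanSpace ℝ (Fin (n + d)))) / r)
              ∂(PoincarePlanes.surfaceMeasure n d M)
            ≤ ENNReal.ofReal (C C_P) * PoincarePlanes.alpha n d M x (lam * r) := by

  -- The added 1 keeps the constant positive when `d = 0`.
  refine ⟨fun _ => 1, fun C_P => d * (C_P * (2 * (d + 1))) + 1, fun _ _ => one_pos,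
    fun C_P h => by positivity, ?_⟩
  intro C_M C_P lam _ hCP hlam M _ _ _ hA hP ε _ _ _ x hx r hr hr1
  have hlr : lam * r ≤ 1 := by
    rw [le_div_iff₀ (by positivity)] at hr1
    nlinarith
  obtain ⟨P, hne, hrank, h⟩ := PoincarePlanes.exists_plane_of_poincare hCP hlam hA hP hx hr hlr
  refine ⟨P, hne, hrank, h.trans ?_⟩
  gcongr
  linarith
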